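/- Fix a signature $\mathcal L=(\mathcal F,\mathcal G)$ in which every connective $k$ has an arity $n_k\ge 0$ and an order type $\epsilon_k\in\{1,\partial\}^{n_k}$. An $\mathcal L$-algebra is a bounded lattice with operations $f$ ($f\in\mathcal F$) and $g$ ($g\in\mathcal G$) such that, in each coordinate, $f$ preserves finite joins (including the empty one) if $\epsilon_f(i)=1$ and turns finite meets into joins if $\epsilon_f(i)=\partial$; dually, $g$ preserves finite meets if $\epsilon_g(i)=1$ and turns finite joins into meets if $\epsilon_g(i)=\partial$. Homomorphisms preserve the bounded lattice structure and all operations. For a relation $R\subseteq X_0\times X_1\times\dots\times X_n$ and $C_i\subseteq X_i$ put $R^{(0)}[C_1,\dots,C_n]=\{x : R(x,\overline c)\text{ for all }\overline c\in \prod_i C_i\}$; for points $x_0,\overline x$ put $R^{(i)}[x_0,\overline x^{\,i}]=\{y\in X_i : R(x_0,x_1,\dots,x_{i-1},y,x_{i+1},\dots,x_n)\}$. An $\mathcal L$-frame is $\mathbb F=(W,U,N,(R_f)_{f},(R_g)_{g})$ with $N\subseteq W\times U$, $R_f\subseteq U\times W^{\epsilon_f}$, $R_g\subseteq W\times U^{\epsilon_g}$,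 where $W^\epsilon=\prod_i W^{\epsilon(i)}$, $U^\epsilon=\prod_i U^{\epsilon(i)}$, $W^1=U^\partial=W$, $W^\partial=U^1=U$, such that all sets $R^{(0)}[\overline x]$ and $R^{(i)}[x_0,\overline x^{\,i}]$ ($1\le i\le n_k$), for $R=R_f$ or $R_g$, are Galois-stable for the polars $\uparrow,\downarrow$ of $N$. Its complex algebra $\mathbb F^+$ is the lattice of concepts $a=([\![a]\!],(\![a]\!))$ of $(W,U,N)$ (extent, intent), ordered by extents, in which $f(\overline a)$ is the concept with intent $R_f^{(0)}[\overline{[\![a]\!]}^{\epsilon_f}]$ and $g(\overline a)$ the concept with extent $R_g^{(0)}[\overline{(\![a]\!)}^{\epsilon_g}]$; in coordinates of order type $\partial$ extents and intents are exchanged. A p-morphism $(S,T):\mathbb F_1\to\mathbb F_2$ consists of $S\subseteq W_1\times U_2$ and $T\subseteq U_1\times W_2$ such that: $S^{(0)}[u]$, $S^{(1)}[w]$ ($u\in U_2$, $w\in W_1$) and $T^{(0)}[w]$, $T^{(1)}[u]$ ($w\in W_2$, $u\in U_1$) are Galois-stable; $(T^{(0)}[w])^\downarrow\subseteq S^{(0)}[w^\uparrow]$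 for $w\in W_2$; $T^{(0)}[(S^{(1)}[w])^\downarrow]\subseteq w^\uparrow$ for $w\in W_1$; and, for all $f,g$ and all $\overline x\in W_2^{\epsilon_f}$, $\overline y\in U_2^{\epsilon_g}$, $$T^{(0)}\big[((R_f^2)^{(0)}[\overline x])^\downarrow\big]=(R_f^1)^{(0)}[\overline{x'}],\qquad S^{(0)}\big[((R_g^2)^{(0)}[\overline y])^\uparrow\big]=(R_g^1)^{(0)}[\overline{y'}],$$ where $z'=(T^{(0)}[z])^\downarrow$ for a coordinate $z\in W_2$ and $z'=(S^{(0)}[z])^\uparrow$ for a coordinate $z\in U_2$. It is surjective if $a\ne b$ implies $S^{(0)}[(\![a]\!)]\ne S^{(0)}[(\![b]\!)]$ for $a,b\in\mathbb F_2^+$ (then $\mathbb F_2$ is a p-morphic image of $\mathbb F_1$), and injective if for every $a\in\mathbb F_1^+$ there is $b\in\mathbb F_2^+$ with $S^{(0)}[(\![b]\!)]=[\![a]\!]$ (then $\mathbb F_1$ is a generated subframe of $\mathbb F_2$). For a map $h:\mathbb F_1^+\to\mathbb F_2^+$ define $(S_h,T_h)$ by $w\,S_h\,u\iff w\in[\![h(u^\downarrow,u^{\downarrow\uparrow})]\!]$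 and $u\,T_h\,w\iff u\in(\![h(w^{\uparrow\downarrow},w^\uparrow)]\!)$, for $w\in W_2,u\in U_1$ and $u\in U_2,w\in W_1$ respectively. The filter-ideal frame $\mathbb F^\star_{\mathbb A}$ of an $\mathcal L$-algebra $\mathbb A$ has $W$ the set of (nonempty, possibly improper) filters and $U$ the set of (nonempty, possibly improper) ideals of $\mathbb A$; $F\,N\,I$ iff $F\cap I\neq\varnothing$; $R_f(I,\overline F)$ iff $f(\overline a)\in I$ for some $\overline a\in\overline F$; and $R_g(F,\overline I)$ iff $g(\overline a)\in F$ for some $\overline a\in\overline I$. Let $e_{\mathbb A}:\mathbb A\to(\mathbb F^\star_{\mathbb A})^+$, $a\mapsto(\{F : a\in F\},\{I : a\in I\})$. For a homomorphism $h:\mathbb A\to\mathbb B$ let $h^\delta:(\mathbb F^\star_{\mathbb A})^+\to(\mathbb F^\star_{\mathbb B})^+$ be $$h^\delta(x)=\bigvee\Big\{\bigwedge\{e_{\mathbb B}(h(a)) : a\in\mathbb A,\ k\le e_{\mathbb A}(a)\} : k \text{ a meet of elements of } e_{\mathbb A}[\mathbb A],\ k\le x\Big\}.$$ **Proposition.**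 Let $h:\mathbb A\to\mathbb B$ be a homomorphism of $\mathcal L$-algebras. Via $e_{\mathbb A}$ and $e_{\mathbb B}$, the complex algebras $(\mathbb F^\star_{\mathbb A})^+$ and $(\mathbb F^\star_{\mathbb B})^+$ are the canonical extensions $\mathbb A^\delta$ and $\mathbb B^\delta$ (dense and compact completions of the bounded lattices, in which each $f$ is interpreted by its $\sigma$-extension and each $g$ by its $\pi$-extension), and $h^\delta$ is a complete homomorphism (preserving arbitrary joins and meets and all operations) that extends $h$. Moreover: 1. If $h$ is injective, then $(S_{h^\delta},T_{h^\delta}):\mathbb F^\star_{\mathbb B}\to\mathbb F^\star_{\mathbb A}$ is a surjective p-morphism; in particular $\mathbb F^\star_{\mathbb A}$ is a p-morphic image of $\mathbb F^\star_{\mathbb B}$. 2. If $h$ is surjective, then $(S_{h^\delta},T_{h^\delta}):\mathbb F^\star_{\mathbb B}\to\mathbb F^\star_{\mathbb A}$ is an injective p-morphism; in particular $\mathbb F^\star_{\mathbb B}$ is a generated subframe of $\mathbb F^\star_{\mathbb A}$. -/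

import Mathlib

open Order

/-! ### Order types and signatures -/

/-- The two values `1` and `∂` of an order type. -/
inductive Sgn : Type
  | one : Sgn
  | dual : Sgn

namespace Sgn

/-- The opposite value. -/
def op : Sgn → Sgn
  | one => dual
  | dual => one

/-- The order of `A` (for `1`) or the converse order (for `∂`). -/
def le {A : Type*} [LE A] : Sgn → A → A → Prop
  | one => fun x y => x ≤ y
  | dual => fun x y => y ≤ x

/-- The join of `A` (for `1`) or of the dual lattice of `A` (for `∂`). -/
def join {A : Type*} [Lattice A] : Sgn → A → A → A
  | one => fun x y => x ⊔ y
  | dual => fun x y => x ⊓ y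

/-- The least element of `A` (for `1`) or of the dual lattice of `A` (for `∂`). -/
def bot (A : Type*) [LE A] [BoundedOrder A] : Sgn → A
  | one => (⊥ : A)
  | dual => (⊤ : A)

end Sgn

set_option linter.checkUnivs false in
/-- A signature: two families of connectives, each with an arity and an order type. -/
structure LESig.{v, w} where
  F : Type v
  G : Type w
  arF : F → ℕ
  arG : G → ℕ
  epsF : (f : F) → Fin (arF f) → Sgn
  epsG : (g : G) → Fin (arG g) → Sgn

/-! ### Normal lattice expansions and their homomorphisms -/

/-- Interpretations of the connectives of `L` on a type. -/
class LEOps (L : LESig) (A : Type*) where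
  opF : (f : L.F) → (Fin (L.arF f) → A) → A
  opG : (g : L.G) → (Fin (L.arG g) → A) → A

/-- `L`-algebras: normal lattice expansions of signature `L`, over a bounded lattice. -/
class LEAlgebra (L : LESig) (A : Type*) [Lattice A] [BoundedOrder A] extends LEOps L A where
  opF_sup : ∀ (f : L.F) (i : Fin (L.arF f)), L.epsF f i = Sgn.one → ∀ (a : Fin (L.arF f) → A)
    (x y : A), opF f (Function.update a i (x ⊔ y)) =
      opF f (Function.update a i x) ⊔ opF f (Function.update a i y)
  opF_bot : ∀ (f : L.F) (i : Fin (L.arF f)), L.epsF f i = Sgn.one → ∀ (a : Fin (L.arF f) → A),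
    opF f (Function.update a i ⊥) = ⊥
  opF_inf : ∀ (f : L.F) (i : Fin (L.arF f)), L.epsF f i = Sgn.dual → ∀ (a : Fin (L.arF f) → A)
    (x y : A), opF f (Function.update a i (x ⊓ y)) =
      opF f (Function.update a i x) ⊔ opF f (Function.update a i y)
  opF_top : ∀ (f : L.F) (i : Fin (L.arF f)), L.epsF f i = Sgn.dual → ∀ (a : Fin (L.arF f) → A),
    opF f (Function.update a i ⊤) = ⊥
  opG_inf : ∀ (g : L.G) (i : Fin (L.arG g)), L.epsG g i = Sgn.one → ∀ (a : Fin (L.arG g) → A)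
    (x y : A), opG g (Function.update a i (x ⊓ y)) =
      opG g (Function.update a i x) ⊓ opG g (Function.update a i y)
  opG_top : ∀ (g : L.G) (i : Fin (L.arG g)), L.epsG g i = Sgn.one → ∀ (a : Fin (L.arG g) → A),
    opG g (Function.update a i ⊤) = ⊤
  opG_sup : ∀ (g : L.G) (i : Fin (L.arG g)), L.epsG g i = Sgn.dual → ∀ (a : Fin (L.arG g) → A)
    (x y : A), opG g (Function.update a i (x ⊔ y)) =
      opG g (Function.update a i x) ⊓ opG g (Function.update a i y)
  opG_bot : ∀ (g : L.G) (i : Fin (L.arG g)), L.epsG g i = Sgn.dual → ∀ (a : Fin (L.arG g) → A),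
    opG g (Function.update a i ⊥) = ⊤

/-- Preservation of all connectives of `L`. -/
structure PreservesOps (L : LESig) {A B : Type*} [LEOps L A] [LEOps L B] (h : A → B) : Prop where
  map_opF : ∀ (f : L.F) (a : Fin (L.arF f) → A),
    h (LEOps.opF f a) = LEOps.opF f (fun i => h (a i))
  map_opG : ∀ (g : L.G) (a : Fin (L.arG g) → A),
    h (LEOps.opG g a) = LEOps.opG g (fun i => h (a i))

/-- Homomorphisms of `L`-algebras. -/
structure LEHom (L : LESig) (A B : Type*) [Lattice A] [BoundedOrder A] [LEAlgebra L A]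
    [Lattice B] [BoundedOrder B] [LEAlgebra L B] extends BoundedLatticeHom A B where
  preservesOps : PreservesOps L toFun

/-- Complete homomorphisms of complete lattices with connectives. -/
structure IsCompleteLEHom (L : LESig) {C D : Type*} [CompleteLattice C] [LEOps L C]
    [CompleteLattice D] [LEOps L D] (h : C → D) : Prop where
  map_sSup : ∀ X : Set C, h (sSup X) = sSup (h '' X)
  map_sInf : ∀ X : Set C, h (sInf X) = sInf (h '' X)
  preservesOps : PreservesOps L h

/-! ### Canonical extensions -/

section CanonicalExtension

variable {A C : Type*} [CompleteLattice C]

/-- Closed elements of `C`: meets of elements of `A`. -/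
def IsClosedElt (e : A → C) (k : C) : Prop := ∃ X : Set A, k = sInf (e '' X)

/-- Open elements of `C`: joins of elements of `A`. -/
def IsOpenElt (e : A → C) (o : C) : Prop := ∃ X : Set A, o = sSup (e '' X)

/-- Closed elements of `C` (for `1`) or of the dual of `C` (for `∂`). -/
def Sgn.IsClosedElt (e : A → C) : Sgn → C → Prop
  | .one => _root_.IsClosedElt e
  | .dual => _root_.IsOpenElt e

/-- The `σ`-extension to `C` of an operation `f` on `A`, regarded as a map `A^ε → A`. -/
def sigmaExt (e : A → C) {n : ℕ} (ε : Fin n → Sgn) (f : (Fin n → A) → A) (x : Fin n → C) : C :=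
  sSup {y | ∃ p : Fin n → C, (∀ i, (ε i).IsClosedElt e (p i)) ∧ (∀ i, (ε i).le (p i) (x i)) ∧
    y = sInf {z | ∃ a : Fin n → A, (∀ i, (ε i).le (p i) (e (a i))) ∧ z = e (f a)}}

/-- The `π`-extension to `C` of an operation `g` on `A`, regarded as a map `A^ε → A`. -/
def piExt (e : A → C) {n : ℕ} (ε : Fin n → Sgn) (g : (Fin n → A) → A) (x : Fin n → C) : C :=
  sInf {y | ∃ q : Fin n → C, (∀ i, (ε i).op.IsClosedElt e (q i)) ∧ (∀ i, (ε i).le (x i) (q i)) ∧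
    y = sSup {z | ∃ a : Fin n → A, (∀ i, (ε i).le (e (a i)) (q i)) ∧ z = e (g a)}}

/-- `e : A → C` exhibits `C` as the canonical extension of the bounded lattice `A`. -/
structure IsCanonicalExtension [Lattice A] [BoundedOrder A] (e : A → C) : Prop where
  injective : Function.Injective e
  map_sup : ∀ a b, e (a ⊔ b) = e a ⊔ e b
  map_inf : ∀ a b, e (a ⊓ b) = e a ⊓ e b
  map_bot : e ⊥ = ⊥
  map_top : e ⊤ = ⊤
  dense_sup : ∀ x : C, ∃ K : Set C, (∀ k ∈ K, IsClosedElt e k) ∧ x = sSup K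
  dense_inf : ∀ x : C, ∃ O : Set C, (∀ o ∈ O, IsOpenElt e o) ∧ x = sInf O
  compact : ∀ X Y : Set A, sInf (e '' X) ≤ sSup (e '' Y) →
    ∃ X' Y' : Finset A, (X' : Set A) ⊆ X ∧ (Y' : Set A) ⊆ Y ∧ X'.inf id ≤ Y'.sup id

/-- `e : A → C` exhibits `C` as the canonical extension of the `L`-algebra `A`. -/
structure IsLECanonicalExtension (L : LESig) [Lattice A] [BoundedOrder A] [LEAlgebra L A]
    [LEOps L C] (e : A → C) : Prop extends IsCanonicalExtension e where
  opF_eq : ∀ (f : L.F) (x : Fin (L.arF f) → C),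
    LEOps.opF f x = sigmaExt e (L.epsF f) (LEOps.opF f) x
  opG_eq : ∀ (g : L.G) (x : Fin (L.arG g) → C),
    LEOps.opG g x = piExt e (L.epsG g) (LEOps.opG g) x

/-- The extension `C → D` of a map `h : A → B`, relative to `e : A → C` and `e' : B → D`:
`x ↦ ⋁ {⋀ {h a | a ∈ A, k ≤ a} | k closed, k ≤ x}`. -/
def canonicalMap {B D : Type*} [CompleteLattice D] (e : A → C) (e' : B → D) (h : A → B)
    (x : C) : D :=
  sSup {y | ∃ k : C, IsClosedElt e k ∧ k ≤ x ∧ y = sInf {z | ∃ a : A, k ≤ e a ∧ z = e' (h a)}}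

end CanonicalExtension

/-! ### Polarities and frames -/

/-- Polarities. -/
structure Polarity.{u} where
  W : Type u
  U : Type u
  N : W → U → Prop

namespace Polarity

universe u

variable (P : Polarity.{u})

/-- `W^1 = W` and `W^∂ = U`. Hence `U^s` is `P.side s.op`. -/
def side : Sgn → Type u
  | .one => P.W
  | .dual => P.U

/-- Galois-stable sets of `W` (for `1`) or of `U` (for `∂`). -/
def IsStable : (s : Sgn) → Set (P.side s) → Prop
  | .one => fun X => IsExtent P.N X
  | .dual => fun Y => IsIntent P.N Y

/-- The component in `W` (for `1`) or in `U` (for `∂`) of a formal concept. -/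
def comp (c : Concept P.W P.U P.N) : (s : Sgn) → Set (P.side s)
  | .one => c.extent
  | .dual => c.intent

/-- The set `R^{(0)}[X₁, …, Xₙ]`. -/
def zeroth {n : ℕ} {t : Sgn} {η : Fin n → Sgn} (R : P.side t → (∀ i, P.side (η i)) → Prop)
    (X : ∀ i, Set (P.side (η i))) : Set (P.side t) :=
  {x | ∀ w : ∀ i, P.side (η i), (∀ i, w i ∈ X i) → R x w}

/-- The sets `R^{(0)}[w]` and `R^{(i)}[x, wⁱ]` are stable, for all points `x` and tuples `w`. -/
def Compatible {n : ℕ} {t : Sgn} {η : Fin n → Sgn}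
    (R : P.side t → (∀ i, P.side (η i)) → Prop) : Prop :=
  (∀ w, P.IsStable t {x | R x w}) ∧
    ∀ x w i, P.IsStable (η i) {y | R x (Function.update w i y)}

variable {P} in
theorem IsStable.zeroth {n : ℕ} {t : Sgn} {η : Fin n → Sgn}
    {R : P.side t → (∀ i, P.side (η i)) → Prop} (hR : P.Compatible R)
    (X : ∀ i, Set (P.side (η i))) : P.IsStable t (P.zeroth R X) := by
  have key : P.zeroth R X =
      ⋂ (w : ∀ i, P.side (η i)) (_ : ∀ i, w i ∈ X i), {x | R x w} := by
    ext x
    simp [Polarity.zeroth]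
  rw [key]
  cases t with
  | one => exact IsExtent.iInter₂ _ fun w _ => hR.1 w
  | dual => exact IsIntent.iInter₂ _ fun w _ => hR.1 w

end Polarity

/-- `L`-frames: `R_f ⊆ U × W^{ε_f}` and `R_g ⊆ W × U^{ε_g}`, all compatible. -/
structure LEFrame.{u, v, w} (L : LESig.{v, w}) extends Polarity.{u} where
  RF : (f : L.F) → toPolarity.side .dual → (∀ i, toPolarity.side (L.epsF f i)) → Prop
  RG : (g : L.G) → toPolarity.side .one → (∀ i, toPolarity.side (L.epsG g i).op) → Prop
  compatF : ∀ f, toPolarity.Compatible (RF f)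
  compatG : ∀ g, toPolarity.Compatible (RG g)

namespace LEFrame

variable {L : LESig} (𝔽 : LEFrame L)

/-- The carrier of the complex algebra: the concept lattice of the polarity. -/
def Complex : Type _ := Concept 𝔽.W 𝔽.U 𝔽.N

noncomputable instance : CompleteLattice 𝔽.Complex :=
  inferInstanceAs (CompleteLattice (Concept 𝔽.W 𝔽.U 𝔽.N))

/-- The operations of the complex algebra. -/
instance : LEOps L 𝔽.Complex where
  opF f a := Concept.ofIsIntent 𝔽.N
    (𝔽.zeroth (𝔽.RF f) fun i => 𝔽.comp (a i) (L.epsF f i)) (Polarity.IsStable.zeroth (𝔽.compatF f) _)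
  opG g a := Concept.ofIsExtent 𝔽.N
    (𝔽.zeroth (𝔽.RG g) fun i => 𝔽.comp (a i) (L.epsG g i).op) (Polarity.IsStable.zeroth (𝔽.compatG g) _)

variable {𝔽}

/-- The extent of an element of the complex algebra. -/
def Complex.ext (a : 𝔽.Complex) : Set 𝔽.W := Concept.extent a

/-- The intent of an element of the complex algebra. -/
def Complex.int (a : 𝔽.Complex) : Set 𝔽.U := Concept.intent a

/-- The element `(w^{↑↓}, w^↑)`. -/
def ofW (w : 𝔽.W) : 𝔽.Complex := Concept.ofObject 𝔽.N w

/-- The element `(u^↓, u^{↓↑})`. -/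
def ofU (u : 𝔽.U) : 𝔽.Complex := Concept.ofAttribute 𝔽.N u

end LEFrame

/-! ### p-morphisms -/

section PMorphism

variable {L : LESig} (𝔽₁ 𝔽₂ : LEFrame L)

/-- For `w ∈ W₂`, the set `(T^{(0)}[w])^↓ ⊆ W₁`; for `u ∈ U₂`, the set `(S^{(0)}[u])^↑ ⊆ U₁`. -/
def pullSide (S : 𝔽₁.W → 𝔽₂.U → Prop) (T : 𝔽₁.U → 𝔽₂.W → Prop) :
    (s : Sgn) → 𝔽₂.side s → Set (𝔽₁.side s)
  | .one => fun w => lowerPolar 𝔽₁.N {u | T u w}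
  | .dual => fun u => upperPolar 𝔽₁.N {w | S w u}

/-- `(S, T) : 𝔽₁ → 𝔽₂` is a p-morphism. Note that `S^{(0)}[Y] = lowerPolar S Y` and
`T^{(0)}[X] = lowerPolar T X`. -/
structure IsPMorphism (S : 𝔽₁.W → 𝔽₂.U → Prop) (T : 𝔽₁.U → 𝔽₂.W → Prop) : Prop where
  p2_zero : ∀ u : 𝔽₂.U, 𝔽₁.IsStable .one {w | S w u}
  p2_one : ∀ w : 𝔽₁.W, 𝔽₂.IsStable .dual {u | S w u}
  p3_zero : ∀ w : 𝔽₂.W, 𝔽₁.IsStable .dual {u | T u w}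
  p3_one : ∀ u : 𝔽₁.U, 𝔽₂.IsStable .one {w | T u w}
  p4 : ∀ w : 𝔽₂.W, lowerPolar 𝔽₁.N {u | T u w} ⊆ lowerPolar S {u | 𝔽₂.N w u}
  p5 : ∀ w : 𝔽₁.W, lowerPolar T (lowerPolar 𝔽₂.N {u | S w u}) ⊆ {u | 𝔽₁.N w u}
  p6 : ∀ (f : L.F) (w : ∀ i, 𝔽₂.side (L.epsF f i)),
    lowerPolar T (lowerPolar 𝔽₂.N {u | 𝔽₂.RF f u w}) =
      𝔽₁.zeroth (𝔽₁.RF f) (fun i => pullSide 𝔽₁ 𝔽₂ S T (L.epsF f i) (w i))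
  p7 : ∀ (g : L.G) (u : ∀ i, 𝔽₂.side (L.epsG g i).op),
    lowerPolar S (upperPolar 𝔽₂.N {w | 𝔽₂.RG g w u}) =
      𝔽₁.zeroth (𝔽₁.RG g) (fun i => pullSide 𝔽₁ 𝔽₂ S T (L.epsG g i).op (u i))

/-- Surjective p-morphisms. -/
structure IsSurjectivePMorphism (S : 𝔽₁.W → 𝔽₂.U → Prop) (T : 𝔽₁.U → 𝔽₂.W → Prop) : Prop
    extends IsPMorphism 𝔽₁ 𝔽₂ S T where
  surj : ∀ a b : 𝔽₂.Complex, a ≠ b → lowerPolar S a.int ≠ lowerPolar S b.int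

/-- Injective p-morphisms. -/
structure IsInjectivePMorphism (S : 𝔽₁.W → 𝔽₂.U → Prop) (T : 𝔽₁.U → 𝔽₂.W → Prop) : Prop
    extends IsPMorphism 𝔽₁ 𝔽₂ S T where
  inj : ∀ a : 𝔽₁.Complex, ∃ b : 𝔽₂.Complex, lowerPolar S b.int = a.ext

/-- `𝔽₂` is a p-morphic image of `𝔽₁`. -/
def IsPMorphicImage : Prop := ∃ S T, IsSurjectivePMorphism 𝔽₁ 𝔽₂ S T

/-- `𝔽₁` is a generated subframe of `𝔽₂`. -/
def IsGeneratedSubframe : Prop := ∃ S T, IsInjectivePMorphism 𝔽₁ 𝔽₂ S T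

variable {𝔽₁ 𝔽₂}

/-- The relation `S_h`, for a map `h : 𝔽₁⁺ → 𝔽₂⁺`. -/
def dualS (h : 𝔽₁.Complex → 𝔽₂.Complex) (w : 𝔽₂.W) (u : 𝔽₁.U) : Prop :=
  w ∈ (h (LEFrame.ofU u)).ext

/-- The relation `T_h`, for a map `h : 𝔽₁⁺ → 𝔽₂⁺`. -/
def dualT (h : 𝔽₁.Complex → 𝔽₂.Complex) (u : 𝔽₂.U) (w : 𝔽₁.W) : Prop :=
  u ∈ (h (LEFrame.ofW w)).int

end PMorphism

/-! ### The filter-ideal frame -/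

section FilterIdeal

universe u

variable (A : Type u) [Lattice A]

/-- The polarity of the (nonempty, possibly improper) filters and ideals of `A`, with
`F N I` iff `F` meets `I`. -/
def fiPolarity : Polarity.{u} where
  W := PFilter A
  U := Ideal A
  N F I := ∃ a : A, a ∈ F ∧ a ∈ I

variable {A}

/-- The underlying subset of `A` of a filter or of an ideal. -/
def fiSet : (s : Sgn) → (fiPolarity A).side s → Set A
  | .one => fun F => {a : A | a ∈ (show PFilter A from F)}
  | .dual => fun I => {a : A | a ∈ (show Ideal A from I)}

/-- `x` is related to `(H₁, …, Hₙ)` iff `op (a₁, …, aₙ) ∈ x` for some `a₁ ∈ H₁, …, aₙ ∈ Hₙ`. -/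
def fiRel {n : ℕ} (t : Sgn) (η : Fin n → Sgn) (op : (Fin n → A) → A)
    (x : (fiPolarity A).side t) (H : ∀ i, (fiPolarity A).side (η i)) : Prop :=
  ∃ a : Fin n → A, (∀ i, a i ∈ fiSet (η i) (H i)) ∧ op a ∈ fiSet t x

theorem Sgn.le_trans' {s : Sgn} {x y z : A} (h : s.le x y) (h' : s.le y z) : s.le x z := by
  cases s
  · exact le_trans (a := x) h h'
  · exact le_trans (a := z) h' h

theorem Sgn.le_refl' (s : Sgn) (x : A) : s.le x x := by
  cases s <;> exact le_refl x

theorem fiSet_upper {s : Sgn} (H : (fiPolarity A).side s) {x y : A} (h : s.le x y)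
    (hx : x ∈ fiSet s H) : y ∈ fiSet s H := by
  cases s with
  | one => exact PFilter.mem_of_le (F := (show PFilter A from H)) h hx
  | dual => exact Ideal.lower (show Ideal A from H) h hx

theorem fiSet_nonempty {s : Sgn} (H : (fiPolarity A).side s) : (fiSet s H).Nonempty := by
  cases s with
  | one => exact PFilter.nonempty (show PFilter A from H)
  | dual => exact Ideal.nonempty (show Ideal A from H)

theorem fiSet_directed {s : Sgn} (H : (fiPolarity A).side s) {x y : A}
    (hx : x ∈ fiSet s H) (hy : y ∈ fiSet s H) : ∃ z ∈ fiSet s H, s.le z x ∧ s.le z y := by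
  cases s with
  | one => exact PFilter.directed (show PFilter A from H) x hx y hy
  | dual => exact Ideal.directed (show Ideal A from H) x hx y hy

theorem fiSet_join {s : Sgn} (H : (fiPolarity A).side s.op) {x y : A}
    (hx : x ∈ fiSet s.op H) (hy : y ∈ fiSet s.op H) : s.join x y ∈ fiSet s.op H := by
  cases s with
  | one => exact Ideal.sup_mem (s := (show Ideal A from H)) hx hy
  | dual => exact PFilter.inf_mem (F := (show PFilter A from H)) hx hy

/-- The points meeting a nonempty directed subset of `A` form a stable set. -/
theorem fi_stable_of_directed {s : Sgn} (X : Set A) (hne : X.Nonempty)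
    (hd : ∀ x ∈ X, ∀ y ∈ X, ∃ z ∈ X, s.op.le z x ∧ s.op.le z y) :
    (fiPolarity A).IsStable s {H | ∃ x ∈ X, x ∈ fiSet s H} := by
  cases s with
  | one =>
    obtain ⟨x₀, hx₀⟩ := hne
    have hI : IsIdeal {b : A | ∃ x ∈ X, b ≤ x} := by
      refine ⟨fun a b hab ⟨x, hx, hax⟩ => ⟨x, hx, le_trans hab hax⟩, ⟨x₀, x₀, hx₀, le_rfl⟩, ?_⟩
      rintro a ⟨x, hx, hax⟩ b ⟨y, hy, hby⟩
      obtain ⟨z, hz, hzx, hzy⟩ := hd x hx y hy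
      exact ⟨z, ⟨z, hz, le_rfl⟩, le_trans hax hzx, le_trans hby hzy⟩
    refine ⟨{hI.toIdeal}, ?_⟩
    ext F
    constructor
    · intro h
      obtain ⟨a, haF, x, hx, hax⟩ := h rfl
      exact ⟨x, hx, fiSet_upper (s := .one) F hax haF⟩
    · rintro ⟨x, hx, hxF⟩ I rfl
      exact ⟨x, hxF, x, hx, le_rfl⟩
  | dual =>
    obtain ⟨x₀, hx₀⟩ := hne
    have hF : IsPFilter {b : A | ∃ x ∈ X, x ≤ b} := by
      refine IsPFilter.of_def ⟨x₀, x₀, hx₀, le_rfl⟩ ?_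
        (fun {a b} hab ⟨x, hx, hxa⟩ => ⟨x, hx, le_trans hxa hab⟩)
      rintro a ⟨x, hx, hxa⟩ b ⟨y, hy, hyb⟩
      obtain ⟨z, hz, hzx, hzy⟩ := hd x hx y hy
      exact ⟨z, ⟨z, hz, le_rfl⟩, le_trans hzx hxa, le_trans hzy hyb⟩
    refine ⟨{hF.toPFilter}, ?_⟩
    ext I
    constructor
    · intro h
      obtain ⟨a, ⟨x, hx, hxa⟩, haI⟩ := h rfl
      exact ⟨x, hx, fiSet_upper (s := .dual) I hxa haI⟩
    · rintro ⟨x, hx, hxI⟩ F rfl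
      exact ⟨x, ⟨x, hx, le_rfl⟩, hxI⟩

theorem fi_monotone {n : ℕ} {t : Sgn} {η : Fin n → Sgn} {op : (Fin n → A) → A}
    (hop : ∀ i a x y, op (Function.update a i ((η i).join x y)) =
      t.join (op (Function.update a i x)) (op (Function.update a i y)))
    {a b : Fin n → A} (hab : ∀ i, (η i).le (a i) (b i)) : t.le (op a) (op b) := by
  have step : ∀ i (c : Fin n → A) (x y : A), (η i).le x y →
      t.le (op (Function.update c i x)) (op (Function.update c i y)) := by
    intro i c x y hxy
    have h1 : (η i).join x y = y := by
      revert hxy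
      cases η i with
      | one => exact fun hxy => sup_eq_right.2 hxy
      | dual => exact fun hxy => inf_eq_right.2 hxy
    have h2 := hop i c x y
    rw [h1] at h2
    rw [h2]
    cases t with
    | one => exact le_sup_left
    | dual => exact inf_le_left
  have main : ∀ s : Finset (Fin n), t.le (op a) (op fun i => if i ∈ s then b i else a i) := by
    intro s
    induction s using Finset.induction_on with
    | empty => simpa using Sgn.le_refl' t (op a)
    | insert j s hj ih =>
      refine Sgn.le_trans' ih ?_
      have e1 : (fun i => if i ∈ s then b i else a i) =
          Function.update (fun i => if i ∈ s then b i else a i) j (a j) := by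
        ext i
        by_cases h : i = j
        · subst h; simp [hj]
        · simp [h]
      have e2 : (fun i => if i ∈ insert j s then b i else a i) =
          Function.update (fun i => if i ∈ s then b i else a i) j (b j) := by
        ext i
        by_cases h : i = j
        · subst h; simp
        · simp [h]
      rw [e1, e2]
      simpa using step j (fun i => if i ∈ s then b i else a i) (a j) (b j) (hab j)
  simpa using main Finset.univ

theorem fi_compatible [BoundedOrder A] {n : ℕ} {t : Sgn} {η : Fin n → Sgn}
    {op : (Fin n → A) → A}
    (hop : ∀ i a x y, op (Function.update a i ((η i).join x y)) =
      t.join (op (Function.update a i x)) (op (Function.update a i y)))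
    (hbot : ∀ i a, op (Function.update a i ((η i).bot A)) = t.bot A) :
    (fiPolarity A).Compatible (fiRel t.op η op) := by
  constructor
  · intro H
    have key : {x | fiRel t.op η op x H} =
        {x | ∃ y ∈ {y | ∃ a : Fin n → A, (∀ i, a i ∈ fiSet (η i) (H i)) ∧ op a = y},
          y ∈ fiSet t.op x} := by
      ext x
      constructor
      · rintro ⟨a, ha, hx⟩
        exact ⟨_, ⟨a, ha, rfl⟩, hx⟩
      · rintro ⟨_, ⟨a, ha, rfl⟩, hx⟩
        exact ⟨a, ha, hx⟩
    rw [key]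
    have htt : t.op.op = t := by cases t <;> rfl
    apply fi_stable_of_directed
    · choose a ha using fun i => fiSet_nonempty (H i)
      exact ⟨_, a, ha, rfl⟩
    · rintro _ ⟨a, ha, rfl⟩ _ ⟨b, hb, rfl⟩
      choose c hc hca hcb using fun i => fiSet_directed (H i) (ha i) (hb i)
      rw [htt]
      exact ⟨_, ⟨c, hc, rfl⟩, fi_monotone hop hca, fi_monotone hop hcb⟩
  · intro x H i
    have key : {y | fiRel t.op η op x (Function.update H i y)} =
        {y | ∃ b ∈ {b | ∃ a : Fin n → A, (∀ j, j ≠ i → a j ∈ fiSet (η j) (H j)) ∧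
          op (Function.update a i b) ∈ fiSet t.op x}, b ∈ fiSet (η i) y} := by
      ext y
      constructor
      · rintro ⟨a, ha, hx⟩
        refine ⟨a i, ⟨a, fun j hj => ?_, by simpa using hx⟩, by simpa using ha i⟩
        simpa [hj] using ha j
      · rintro ⟨b, ⟨a, ha, hx⟩, hb⟩
        refine ⟨Function.update a i b, fun j => ?_, hx⟩
        by_cases hj : j = i
        · subst hj; simpa using hb
        · simpa [hj] using ha j hj
    rw [key]
    choose d hd using fun j => fiSet_nonempty (H j)
    apply fi_stable_of_directed
    · refine ⟨(η i).bot A, d, fun j _ => hd j, ?_⟩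
      rw [hbot]
      obtain ⟨z, hz⟩ := fiSet_nonempty x
      refine fiSet_upper x ?_ hz
      cases t with
      | one => exact bot_le
      | dual => exact le_top
    · rintro b ⟨a, ha, hab⟩ b' ⟨a', ha', hab'⟩
      have hc : ∀ j, ∃ z, (j ≠ i → z ∈ fiSet (η j) (H j)) ∧
          (j ≠ i → (η j).le z (a j)) ∧ (j ≠ i → (η j).le z (a' j)) := by
        intro j
        by_cases hj : j = i
        · exact ⟨d j, fun h => (h hj).elim, fun h => (h hj).elim, fun h => (h hj).elim⟩
        · obtain ⟨z, hz, h1, h2⟩ := fiSet_directed (H j) (ha j hj) (ha' j hj)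
          exact ⟨z, fun _ => hz, fun _ => h1, fun _ => h2⟩
      choose c hc hca hca' using hc
      have toOp : ∀ {y z : A}, t.le y z → t.op.le z y := by
        intro y z h
        cases t <;> exact h
      have low : ∀ (a : Fin n → A) (b : A), (∀ j, j ≠ i → (η j).le (c j) (a j)) →
          op (Function.update a i b) ∈ fiSet t.op x →
          op (Function.update c i b) ∈ fiSet t.op x := by
        intro a b hca hab
        refine fiSet_upper x (toOp (fi_monotone hop fun j => ?_)) hab
        by_cases hj : j = i
        · subst hj; simpa using Sgn.le_refl' (η j) b
        · simpa [hj] using hca j hj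
      refine ⟨(η i).join b b', ⟨c, hc, ?_⟩, ?_, ?_⟩
      · rw [hop]
        exact fiSet_join x (low a b hca hab) (low a' b' hca' hab')
      · cases η i with
        | one => exact le_sup_left
        | dual => exact inf_le_left
      · cases η i with
        | one => exact le_sup_right
        | dual => exact inf_le_right

variable (A) in
/-- The filter-ideal frame of an `L`-algebra: `R_f (I, F₁, …, Fₙ)` iff `f (a₁, …, aₙ) ∈ I` for
some `a₁ ∈ F₁, …, aₙ ∈ Fₙ`, and `R_g (F, I₁, …, Iₙ)` iff `g (a₁, …, aₙ) ∈ F` for some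
`a₁ ∈ I₁, …, aₙ ∈ Iₙ` (with filters and ideals exchanged in coordinates of order type `∂`). -/
def fiFrame (L : LESig) [BoundedOrder A] [LEAlgebra L A] : LEFrame L where
  toPolarity := fiPolarity A
  RF f := fiRel .dual (L.epsF f) (LEOps.opF f)
  RG g := fiRel .one (fun i => (L.epsG g i).op) (LEOps.opG g)
  compatF f := by
    refine fi_compatible (t := .one) (fun i a x y => ?_) (fun i a => ?_)
    · cases h : L.epsF f i with
      | one => exact LEAlgebra.opF_sup f i h a x y
      | dual => exact LEAlgebra.opF_inf f i h a x y
    · cases h : L.epsF f i with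
      | one => exact LEAlgebra.opF_bot f i h a
      | dual => exact LEAlgebra.opF_top f i h a
  compatG g := by
    refine fi_compatible (t := .dual) (fun i a x y => ?_) (fun i a => ?_)
    · cases h : L.epsG g i with
      | one => exact LEAlgebra.opG_inf g i h a x y
      | dual => exact LEAlgebra.opG_sup g i h a x y
    · cases h : L.epsG g i with
      | one => exact LEAlgebra.opG_top g i h a
      | dual => exact LEAlgebra.opG_bot g i h a

/-- The embedding of `A` into the complex algebra of its filter-ideal frame:
`a ↦ ({F | a ∈ F}, {I | a ∈ I})`. -/
def fiEmbed (L : LESig) [BoundedOrder A] [LEAlgebra L A] (a : A) : (fiFrame A L).Complex :=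
  show Concept (PFilter A) (Ideal A) (fiPolarity A).N from
  { extent := {F | a ∈ F}
    intent := {I | a ∈ I}
    upperPolar_extent := by
      ext I
      constructor
      · intro h
        obtain ⟨b, hb, hbI⟩ := h (a := PFilter.principal a) (PFilter.mem_principal.2 le_rfl)
        exact Ideal.lower I (PFilter.mem_principal.1 hb) hbI
      · exact fun h F hF => ⟨a, hF, h⟩
    lowerPolar_intent := by
      ext F
      constructor
      · intro h
        obtain ⟨b, hbF, hb⟩ := h (b := Ideal.principal a) (Ideal.mem_principal.2 le_rfl)
        exact PFilter.mem_of_le (F := F) (Ideal.mem_principal.1 hb) hbF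
      · exact fun h I hI => ⟨a, h, hI⟩ }

/-- The canonical extension `h^δ : A^δ → B^δ` of a homomorphism, where `A^δ` and `B^δ` are the
complex algebras of the filter-ideal frames of `A` and `B`. -/
noncomputable def LEHom.delta {L : LESig} {B : Type*} [BoundedOrder A] [LEAlgebra L A] [Lattice B]
    [BoundedOrder B] [LEAlgebra L B] (h : LEHom L A B) :
    (fiFrame A L).Complex → (fiFrame B L).Complex :=
  canonicalMap (fiEmbed L) (fiEmbed L) h.toFun

end FilterIdeal

/-! ### Elements of complex algebras -/

/-! In the filter-ideal frame the concepts generated by filters are exactly the closed elements,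
those generated by ideals exactly the open ones, and the first lies below the second iff the filter
meets the ideal. Density is then the generation of a concept lattice by its object and attribute
concepts, and compactness is the description of a generated filter meeting a generated ideal.
Compatibility of the frame relations turns the complex operations into the σ- and π-extensions
(`opF_eq_sigmaExt`, `opG_eq_piExt`).

The rest is governed by one fact: `h.delta` acts by preimage. A filter lies in the extent of
`h.delta x` iff its preimage under `h` lies in the extent of `x` (`mem_ext_delta`), and likewise for
ideals and intents (`mem_int_delta`). Meets are intersections of extents and joins are intersections
of intents, and preimage commutes with both. For the connectives, quantification over tuples of
filters and ideals is moved between `A` and `B` by `fiRel_forall_fiComap_iff`, which also yields the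
last two p-morphism conditions.

Surjectivity and injectivity of the p-morphism amount to injectivity and surjectivity of `h.delta`,
by `lowerPolar_dualS_int`. The former comes from injective `h` because a filter is recovered as the
preimage of its image, the latter from surjective `h` because every closed element of the target is
hit. -/

theorem Sgn.op_le_iff {A : Type*} [LE A] {s : Sgn} {x y : A} : s.op.le x y ↔ s.le y x := by
  cases s <;> exact Iff.rfl

namespace LEFrame

variable {L : LESig} {𝔽 : LEFrame L}

theorem ofW_le {w : 𝔽.W} {c : 𝔽.Complex} : ofW w ≤ c ↔ w ∈ c.ext :=
  (Concept.ofObjects_le_iff (r := 𝔽.N) (c := c) (s := {w})).trans Set.singleton_subset_iff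

theorem le_ofU {u : 𝔽.U} {c : 𝔽.Complex} : c ≤ ofU u ↔ u ∈ c.int :=
  (Concept.le_ofAttributes_iff (r := 𝔽.N) (c := c) (t := {u})).trans Set.singleton_subset_iff

theorem ofW_le_ofU {w : 𝔽.W} {u : 𝔽.U} : (ofW w : 𝔽.Complex) ≤ ofU u ↔ 𝔽.N w u :=
  Concept.ofObject_le_ofAttribute_iff (r := 𝔽.N)

namespace Complex

theorem eq_of_ext {a b : 𝔽.Complex} (h : ∀ w, w ∈ a.ext ↔ w ∈ b.ext) : a = b :=
  Concept.ext (c := a) (d := b) (Set.ext h)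

theorem eq_of_int {a b : 𝔽.Complex} (h : ∀ u, u ∈ a.int ↔ u ∈ b.int) : a = b :=
  Concept.ext' (c := a) (d := b) (Set.ext h)

theorem mem_ext_iff {a : 𝔽.Complex} {w : 𝔽.W} : w ∈ a.ext ↔ ∀ u ∈ a.int, 𝔽.N w u := by
  have := Concept.lowerPolar_intent (r := 𝔽.N) a
  exact (Set.ext_iff.1 this w).symm

theorem mem_int_iff {a : 𝔽.Complex} {u : 𝔽.U} : u ∈ a.int ↔ ∀ w ∈ a.ext, 𝔽.N w u := by
  have := Concept.upperPolar_extent (r := 𝔽.N) a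
  exact (Set.ext_iff.1 this u).symm

theorem mem_ext_sInf {S : Set 𝔽.Complex} {w : 𝔽.W} : w ∈ (sInf S).ext ↔ ∀ c ∈ S, w ∈ c.ext := by
  simp only [← ofW_le, le_sInf_iff]

theorem mem_int_sSup {S : Set 𝔽.Complex} {u : 𝔽.U} : u ∈ (sSup S).int ↔ ∀ c ∈ S, u ∈ c.int := by
  simp only [← le_ofU, sSup_le_iff]

theorem eq_sSup_ofW (c : 𝔽.Complex) : c = sSup (ofW '' c.ext) := by
  apply eq_of_int
  intro u
  rw [mem_int_sSup, Set.forall_mem_image, mem_int_iff]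
  exact forall₂_congr fun w _ => ofW_le_ofU.symm.trans le_ofU

theorem eq_sInf_ofU (c : 𝔽.Complex) : c = sInf (ofU '' c.int) := by
  apply eq_of_ext
  intro w
  rw [mem_ext_sInf, Set.forall_mem_image, mem_ext_iff]
  exact forall₂_congr fun u _ => ofW_le_ofU.symm.trans ofW_le

end Complex

/-- The element of the complex algebra generated by a point of `W` or of `U`. -/
def ofSide : (s : Sgn) → 𝔽.side s → 𝔽.Complex
  | .one => ofW
  | .dual => ofU

/-- With `s.le` in place of `≤`, coordinates of both order types are handled by a single statement.
-/
theorem ofSide_le {s : Sgn} {x : 𝔽.side s} {c : 𝔽.Complex} :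
    s.le (ofSide s x) c ↔ x ∈ 𝔽.comp c s := by
  cases s with
  | one => exact ofW_le
  | dual => exact le_ofU

end LEFrame

open LEFrame LEFrame.Complex

/-! ### The filter-ideal frame as a canonical extension -/

/-- The filter generated by a set. -/
def filterGenerated {A : Type*} [Lattice A] [BoundedOrder A] (X : Set A) : PFilter A :=
  IsPFilter.toPFilter (F := {a | ∃ X' : Finset A, (X' : Set A) ⊆ X ∧ X'.inf id ≤ a}) <| by
    classical
    refine IsPFilter.of_def ⟨⊤, ∅, by simp, le_top⟩ ?_ ?_
    · rintro a ⟨X₁, h₁, ha⟩ b ⟨X₂, h₂, hb⟩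
      refine ⟨a ⊓ b, ⟨X₁ ∪ X₂, by simp [h₁, h₂], ?_⟩, inf_le_left, inf_le_right⟩
      rw [Finset.inf_union]
      exact inf_le_inf ha hb
    · rintro a b hab ⟨X', hX', ha⟩
      exact ⟨X', hX', ha.trans hab⟩

/-- The ideal generated by a set. -/
def idealGenerated {A : Type*} [Lattice A] [BoundedOrder A] (X : Set A) : Ideal A :=
  IsIdeal.toIdeal (I := {a | ∃ X' : Finset A, (X' : Set A) ⊆ X ∧ a ≤ X'.sup id}) <| by
    classical
    refine ⟨?_, ⟨⊥, ∅, by simp, bot_le⟩, ?_⟩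
    · rintro a b hab ⟨X', hX', ha⟩
      exact ⟨X', hX', hab.trans ha⟩
    · rintro a ⟨X₁, h₁, ha⟩ b ⟨X₂, h₂, hb⟩
      refine ⟨a ⊔ b, ⟨X₁ ∪ X₂, by simp [h₁, h₂], ?_⟩, le_sup_left, le_sup_right⟩
      rw [Finset.sup_union]
      exact sup_le_sup ha hb

section CanonicalExtension

variable {A : Type*} [Lattice A] [BoundedOrder A]

theorem mem_filterGenerated {X : Set A} {a : A} :
    a ∈ filterGenerated X ↔ ∃ X' : Finset A, (X' : Set A) ⊆ X ∧ X'.inf id ≤ a :=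
  Iff.rfl

theorem mem_idealGenerated {X : Set A} {a : A} :
    a ∈ idealGenerated X ↔ ∃ X' : Finset A, (X' : Set A) ⊆ X ∧ a ≤ X'.sup id :=
  Iff.rfl

theorem filterGenerated_subset {X : Set A} {F : PFilter A} (h : ∀ x ∈ X, x ∈ F) {a : A}
    (ha : a ∈ filterGenerated X) : a ∈ F := by
  obtain ⟨X', hX', ha⟩ := mem_filterGenerated.1 ha
  refine PFilter.mem_of_le ha (Finset.inf_induction (p := (· ∈ F)) PFilter.top_mem
    (fun _ hx _ hy => PFilter.inf_mem hx hy) fun x hx => h x (hX' hx))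

theorem idealGenerated_subset {X : Set A} {I : Ideal A} (h : ∀ x ∈ X, x ∈ I) {a : A}
    (ha : a ∈ idealGenerated X) : a ∈ I := by
  obtain ⟨X', hX', ha⟩ := mem_idealGenerated.1 ha
  exact I.lower ha (Finset.sup_induction (p := (· ∈ I)) I.bot_mem
    (fun _ hx _ hy => Ideal.sup_mem hx hy) fun x hx => h x (hX' hx))

variable {L : LESig} [LEAlgebra L A]

theorem ofW_le_fiEmbed {F : PFilter A} {a : A} :
    (ofW F : (fiFrame A L).Complex) ≤ fiEmbed L a ↔ a ∈ F :=
  ofW_le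

theorem fiEmbed_le_ofU {I : Ideal A} {a : A} :
    fiEmbed L a ≤ (ofU I : (fiFrame A L).Complex) ↔ a ∈ I :=
  le_ofU

/-- Testing against the elements `fiEmbed L a` suffices, since a filter meets an ideal in such an
`a`. Closed elements are thus ordered by reverse inclusion of filters. -/
theorem mem_ext_ofW {F G : PFilter A} :
    G ∈ (ofW F : (fiFrame A L).Complex).ext ↔ ∀ a ∈ F, a ∈ G := by
  constructor
  · exact fun h a ha => ofW_le_fiEmbed.1 ((ofW_le.2 h).trans (ofW_le_fiEmbed.2 ha))
  · intro h
    refine mem_ext_iff.2 fun I hI => ?_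
    obtain ⟨a, ha, haI⟩ := ofW_le_ofU.1 (le_ofU.2 hI)
    exact ⟨a, h a ha, haI⟩

theorem mem_int_ofU {I J : Ideal A} :
    J ∈ (ofU I : (fiFrame A L).Complex).int ↔ ∀ a ∈ I, a ∈ J := by
  constructor
  · exact fun h a ha => fiEmbed_le_ofU.1 ((fiEmbed_le_ofU.2 ha).trans (le_ofU.2 h))
  · intro h
    refine mem_int_iff.2 fun F hF => ?_
    obtain ⟨a, haF, ha⟩ := ofW_le_ofU.1 (ofW_le.2 hF)
    exact ⟨a, haF, h a ha⟩

theorem sInf_fiEmbed_image (X : Set A) :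
    sInf (fiEmbed L '' X) = (ofW (filterGenerated X) : (fiFrame A L).Complex) := by
  apply eq_of_ext
  intro F
  rw [mem_ext_sInf, Set.forall_mem_image]
  refine Iff.trans ?_ mem_ext_ofW.symm
  exact ⟨fun h a ha => filterGenerated_subset (fun x hx => h hx) ha,
    fun h x hx => h x (mem_filterGenerated.2 ⟨{x}, by simpa using hx, by simp⟩)⟩

theorem sSup_fiEmbed_image (X : Set A) :
    sSup (fiEmbed L '' X) = (ofU (idealGenerated X) : (fiFrame A L).Complex) := by
  apply eq_of_int
  intro I
  rw [mem_int_sSup, Set.forall_mem_image]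
  refine Iff.trans ?_ mem_int_ofU.symm
  exact ⟨fun h a ha => idealGenerated_subset (fun x hx => h hx) ha,
    fun h x hx => h x (mem_idealGenerated.2 ⟨{x}, by simpa using hx, by simp⟩)⟩

theorem isClosedElt_fiEmbed_iff {k : (fiFrame A L).Complex} :
    IsClosedElt (fiEmbed L) k ↔ ∃ F : PFilter A, k = ofW F := by
  constructor
  · rintro ⟨X, rfl⟩
    exact ⟨_, sInf_fiEmbed_image X⟩
  · rintro ⟨F, rfl⟩
    refine ⟨{a | a ∈ F}, eq_of_ext fun G => ?_⟩
    rw [mem_ext_sInf, Set.forall_mem_image]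
    exact mem_ext_ofW

theorem isOpenElt_fiEmbed_iff {k : (fiFrame A L).Complex} :
    IsOpenElt (fiEmbed L) k ↔ ∃ I : Ideal A, k = ofU I := by
  constructor
  · rintro ⟨X, rfl⟩
    exact ⟨_, sSup_fiEmbed_image X⟩
  · rintro ⟨I, rfl⟩
    refine ⟨{a | a ∈ I}, eq_of_int fun J => ?_⟩
    rw [mem_int_sSup, Set.forall_mem_image]
    exact mem_int_ofU

theorem Sgn.isClosedElt_fiEmbed_iff {s : Sgn} {k : (fiFrame A L).Complex} :
    s.IsClosedElt (fiEmbed L) k ↔ ∃ H : (fiPolarity A).side s, k = ofSide s H := by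
  cases s with
  | one => exact _root_.isClosedElt_fiEmbed_iff
  | dual => exact isOpenElt_fiEmbed_iff

theorem mem_comp_fiEmbed {s : Sgn} {H : (fiPolarity A).side s} {a : A} :
    H ∈ (fiFrame A L).comp (fiEmbed L a) s ↔ a ∈ fiSet s H := by
  cases s <;> exact Iff.rfl

/-- A larger filter generates a smaller concept, and a larger ideal a larger one, so extents and
intents are closed under enlarging points. -/
theorem mem_comp_of_subset {s : Sgn} {H H' : (fiPolarity A).side s} {c : (fiFrame A L).Complex}
    (hH : H ∈ (fiFrame A L).comp c s) (h : fiSet s H ⊆ fiSet s H') :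
    H' ∈ (fiFrame A L).comp c s := by
  cases s with
  | one => exact ofW_le.1 ((ofW_le.2 (mem_ext_ofW.2 fun a ha => h ha)).trans (ofW_le.2 hH))
  | dual => exact le_ofU.1 ((le_ofU.2 hH).trans (le_ofU.2 (mem_int_ofU.2 fun a ha => h ha)))

theorem isCanonicalExtension_fiEmbed :
    IsCanonicalExtension (fiEmbed L : A → (fiFrame A L).Complex) where
  injective a b hab := by
    refine le_antisymm ?_ ?_
    · have h : fiEmbed L a ≤ (ofU (Ideal.principal b) : (fiFrame A L).Complex) :=
        hab ▸ fiEmbed_le_ofU.2 (Ideal.mem_principal.2 le_rfl)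
      exact Ideal.mem_principal.1 (fiEmbed_le_ofU.1 h)
    · have h : fiEmbed L b ≤ (ofU (Ideal.principal a) : (fiFrame A L).Complex) :=
        hab ▸ fiEmbed_le_ofU.2 (Ideal.mem_principal.2 le_rfl)
      exact Ideal.mem_principal.1 (fiEmbed_le_ofU.1 h)
  map_sup a b := by
    apply eq_of_int
    intro I
    rw [← le_ofU, ← le_ofU, sup_le_iff]
    refine fiEmbed_le_ofU.trans (Iff.trans ?_ (and_congr fiEmbed_le_ofU fiEmbed_le_ofU).symm)
    exact Ideal.sup_mem_iff
  map_inf a b := by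
    apply eq_of_ext
    intro F
    rw [← ofW_le, ← ofW_le, le_inf_iff]
    refine ofW_le_fiEmbed.trans (Iff.trans ?_ (and_congr ofW_le_fiEmbed ofW_le_fiEmbed).symm)
    exact PFilter.inf_mem_iff
  map_bot := by
    apply eq_of_int
    intro I
    rw [← le_ofU, ← le_ofU]
    exact iff_of_true (fiEmbed_le_ofU.2 (Ideal.bot_mem I)) bot_le
  map_top := by
    apply eq_of_ext
    intro F
    rw [← ofW_le, ← ofW_le]
    exact iff_of_true (ofW_le_fiEmbed.2 PFilter.top_mem) le_top
  dense_sup x := ⟨_, by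
    rintro _ ⟨F, -, rfl⟩
    exact isClosedElt_fiEmbed_iff.2 ⟨F, rfl⟩, eq_sSup_ofW x⟩
  dense_inf x := ⟨_, by
    rintro _ ⟨I, -, rfl⟩
    exact isOpenElt_fiEmbed_iff.2 ⟨I, rfl⟩, eq_sInf_ofU x⟩
  compact X Y h := by
    rw [sInf_fiEmbed_image, sSup_fiEmbed_image] at h
    -- The inequality between a closed and an open element says that the filter and the ideal share
    -- an element; it lies above a finite meet from `X` and below a finite join from `Y`.
    obtain ⟨a, haX, haY⟩ := ofW_le_ofU.1 h
    obtain ⟨X', hX', ha⟩ := mem_filterGenerated.1 haX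
    obtain ⟨Y', hY', ha'⟩ := mem_idealGenerated.1 haY
    exact ⟨X', Y', hX', hY', ha.trans ha'⟩

/-! ### The operations of the complex algebra as σ- and π-extensions -/

theorem mem_int_opF {f : L.F} {x : Fin (L.arF f) → (fiFrame A L).Complex}
    {I : (fiPolarity A).side .dual} :
    I ∈ (LEOps.opF f x : (fiFrame A L).Complex).int ↔
      ∀ H : ∀ i, (fiPolarity A).side (L.epsF f i),
        (∀ i, H i ∈ (fiFrame A L).comp (x i) (L.epsF f i)) →
          fiRel .dual (L.epsF f) (LEOps.opF f) I H :=
  Iff.rfl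

theorem mem_ext_opG {g : L.G} {x : Fin (L.arG g) → (fiFrame A L).Complex}
    {F : (fiPolarity A).side .one} :
    F ∈ (LEOps.opG g x : (fiFrame A L).Complex).ext ↔
      ∀ H : ∀ i, (fiPolarity A).side (L.epsG g i).op,
        (∀ i, H i ∈ (fiFrame A L).comp (x i) (L.epsG g i).op) →
          fiRel .one (fun i => (L.epsG g i).op) (LEOps.opG g) F H :=
  Iff.rfl

theorem opF_eq_sigmaExt (f : L.F) (x : Fin (L.arF f) → (fiFrame A L).Complex) :
    LEOps.opF f x = sigmaExt (fiEmbed L) (L.epsF f) (LEOps.opF f) x := by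
  apply eq_of_int
  intro I
  rw [sigmaExt, mem_int_sSup]
  constructor
  · rintro hI _ ⟨p, hp, hpx, rfl⟩
    choose H hH using fun i => Sgn.isClosedElt_fiEmbed_iff.1 (hp i)
    obtain rfl : p = fun i => ofSide _ (H i) := funext hH
    obtain ⟨a, ha, haI⟩ := mem_int_opF.1 hI H fun i => ofSide_le.1 (hpx i)
    have hle : fiEmbed L (LEOps.opF f a) ≤ (ofU I : (fiFrame A L).Complex) :=
      fiEmbed_le_ofU.2 haI
    exact le_ofU.1 (le_trans
      (sInf_le ⟨a, fun i => ofSide_le.2 (mem_comp_fiEmbed.2 (ha i)), rfl⟩) hle)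
  · intro h H hH
    have hI := h _ ⟨fun i => ofSide _ (H i), fun i => Sgn.isClosedElt_fiEmbed_iff.2 ⟨H i, rfl⟩,
      fun i => ofSide_le.2 (hH i), rfl⟩
    -- The ideals related to `H` form a stable set, so it is enough that `I` meets every filter `F`
    -- in its lower polar. Such an `F` contains each `f a` with `a` in `H`, as the principal ideal
    -- of `f a` is related to `H`; hence `F` lies in the extent of the meet of these values.
    have hst := isIntent_iff.1 (((fiFrame A L).compatF f).1 H)
    refine (Set.ext_iff.1 hst I).1 fun F hF => ?_
    refine mem_int_iff.1 hI F (mem_ext_sInf.2 ?_)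
    rintro _ ⟨a, ha, rfl⟩
    obtain ⟨b, hbF, hb⟩ := hF (b := Ideal.principal (LEOps.opF f a))
      ⟨a, fun i => mem_comp_fiEmbed.1 (ofSide_le.1 (ha i)), Ideal.mem_principal.2 le_rfl⟩
    exact PFilter.mem_of_le (Ideal.mem_principal.1 hb) hbF

theorem opG_eq_piExt (g : L.G) (x : Fin (L.arG g) → (fiFrame A L).Complex) :
    LEOps.opG g x = piExt (fiEmbed L) (L.epsG g) (LEOps.opG g) x := by
  apply eq_of_ext
  intro F
  rw [piExt, mem_ext_sInf]
  constructor
  · rintro hF _ ⟨q, hq, hxq, rfl⟩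
    choose H hH using fun i => Sgn.isClosedElt_fiEmbed_iff.1 (hq i)
    obtain rfl : q = fun i => ofSide _ (H i) := funext hH
    obtain ⟨a, ha, haF⟩ :=
      mem_ext_opG.1 hF H fun i => ofSide_le.1 (Sgn.op_le_iff.2 (hxq i))
    rw [← ofW_le]
    exact (ofW_le_fiEmbed.2 haF).trans (le_sSup
      ⟨a, fun i => Sgn.op_le_iff.1 (ofSide_le.2 (mem_comp_fiEmbed.2 (ha i))), rfl⟩)
  · intro h H hH
    have hF := h _ ⟨fun i => ofSide _ (H i), fun i => Sgn.isClosedElt_fiEmbed_iff.2 ⟨H i, rfl⟩,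
      fun i => Sgn.op_le_iff.1 (ofSide_le.2 (hH i)), rfl⟩
    have hst := isExtent_iff.1 (((fiFrame A L).compatG g).1 H)
    refine (Set.ext_iff.1 hst F).1 fun I hI => ?_
    refine mem_ext_iff.1 hF I (mem_int_sSup.2 ?_)
    rintro _ ⟨a, ha, rfl⟩
    obtain ⟨b, hb, hbI⟩ := hI (a := PFilter.principal (LEOps.opG g a))
      ⟨a, fun i => mem_comp_fiEmbed.1 (ofSide_le.1 (Sgn.op_le_iff.2 (ha i))),
        PFilter.mem_principal.2 le_rfl⟩
    exact Ideal.lower _ (PFilter.mem_principal.1 hb) hbI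

theorem isLECanonicalExtension_fiEmbed :
    IsLECanonicalExtension L (fiEmbed L : A → (fiFrame A L).Complex) where
  toIsCanonicalExtension := isCanonicalExtension_fiEmbed
  opF_eq := opF_eq_sigmaExt
  opG_eq := opG_eq_piExt

end CanonicalExtension

/-! ### Images and preimages of filters and ideals -/

section Delta

variable {A B : Type*} [Lattice A] [BoundedOrder A] [Lattice B] [BoundedOrder B]

/-- The preimage of a filter or ideal under a homomorphism. -/
def fiComap (φ : BoundedLatticeHom A B) :
    (s : Sgn) → (fiPolarity B).side s → (fiPolarity A).side s
  | .one => fun F => IsPFilter.toPFilter (F := {a : A | φ a ∈ (show PFilter B from F)}) <| by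
      refine IsPFilter.of_def ⟨⊤, ?_⟩ (fun a ha b hb => ⟨a ⊓ b, ?_, inf_le_left, inf_le_right⟩)
        fun hab ha => PFilter.mem_of_le (OrderHomClass.mono φ hab) ha
      · change φ ⊤ ∈ (show PFilter B from F)
        rw [map_top]
        exact PFilter.top_mem
      · change φ (a ⊓ b) ∈ (show PFilter B from F)
        rw [map_inf]
        exact PFilter.inf_mem ha hb
  | .dual => fun I => IsIdeal.toIdeal (I := {a : A | φ a ∈ (show Ideal B from I)}) <| by
      refine ⟨fun _ _ hab ha => Ideal.lower _ (OrderHomClass.mono φ hab) ha, ⟨⊥, ?_⟩,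
        fun a ha b hb => ⟨a ⊔ b, ?_, le_sup_left, le_sup_right⟩⟩
      · change φ ⊥ ∈ (show Ideal B from I)
        rw [map_bot]
        exact Ideal.bot_mem _
      · change φ (a ⊔ b) ∈ (show Ideal B from I)
        rw [map_sup]
        exact Ideal.sup_mem ha hb

/-- The filter or ideal generated by the image of a filter or ideal under a homomorphism. -/
def fiMap (φ : BoundedLatticeHom A B) :
    (s : Sgn) → (fiPolarity A).side s → (fiPolarity B).side s
  | .one => fun F => IsPFilter.toPFilter
      (F := {b | ∃ a ∈ (show PFilter A from F), φ a ≤ b}) <|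
      IsPFilter.of_def ⟨⊤, ⊤, PFilter.top_mem, le_top⟩
        (by
          rintro b ⟨a, ha, hb⟩ b' ⟨a', ha', hb'⟩
          refine ⟨b ⊓ b', ⟨a ⊓ a', PFilter.inf_mem ha ha', ?_⟩, inf_le_left, inf_le_right⟩
          rw [map_inf]
          exact inf_le_inf hb hb')
        (by
          rintro b b' hbb ⟨a, ha, hb⟩
          exact ⟨a, ha, hb.trans hbb⟩)
  | .dual => fun I => IsIdeal.toIdeal (I := {b | ∃ a ∈ (show Ideal A from I), b ≤ φ a})
      ⟨by
          rintro b b' hbb ⟨a, ha, hb⟩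
          exact ⟨a, ha, hbb.trans hb⟩,
        ⟨⊥, ⊥, Ideal.bot_mem _, bot_le⟩,
        by
          rintro b ⟨a, ha, hb⟩ b' ⟨a', ha', hb'⟩
          refine ⟨b ⊔ b', ⟨a ⊔ a', Ideal.sup_mem ha ha', ?_⟩, le_sup_left, le_sup_right⟩
          rw [map_sup]
          exact sup_le_sup hb hb'⟩

theorem mem_fiSet_fiComap {φ : BoundedLatticeHom A B} {s : Sgn} {H : (fiPolarity B).side s}
    {a : A} : a ∈ fiSet s (fiComap φ s H) ↔ φ a ∈ fiSet s H := by
  cases s <;> exact Iff.rfl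

theorem mem_fiSet_fiMap {φ : BoundedLatticeHom A B} {s : Sgn} {H : (fiPolarity A).side s}
    {b : B} : b ∈ fiSet s (fiMap φ s H) ↔ ∃ a ∈ fiSet s H, s.le (φ a) b := by
  cases s <;> exact Iff.rfl

theorem fiSet_subset_fiComap_fiMap (φ : BoundedLatticeHom A B) {s : Sgn}
    (H : (fiPolarity A).side s) : fiSet s H ⊆ fiSet s (fiComap φ s (fiMap φ s H)) :=
  fun a ha => mem_fiSet_fiComap.2 (mem_fiSet_fiMap.2 ⟨a, ha, Sgn.le_refl' s _⟩)

/-- An injective lattice homomorphism reflects the order. -/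
theorem fiSet_fiComap_fiMap_subset {φ : BoundedLatticeHom A B} (hφ : Function.Injective φ)
    {s : Sgn} (H : (fiPolarity A).side s) : fiSet s (fiComap φ s (fiMap φ s H)) ⊆ fiSet s H := by
  intro a ha
  obtain ⟨c, hc, hca⟩ := mem_fiSet_fiMap.1 (mem_fiSet_fiComap.1 ha)
  refine fiSet_upper H ?_ hc
  cases s with
  | one => exact inf_eq_left.1 (hφ ((map_inf φ c a).trans (inf_eq_left.2 hca)))
  | dual => exact inf_eq_left.1 (hφ ((map_inf φ a c).trans (inf_eq_left.2 hca)))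

/-! ### The canonical extension of a homomorphism -/

variable {L : LESig} [LEAlgebra L A] [LEAlgebra L B] (h : LEHom L A B)

/-- This computes the inner meet in the definition of `h.delta`: the closed element of `F` goes to
the closed element of the filter generated by the image of `F`. -/
theorem sInf_fiEmbed_comp (F : PFilter A) :
    sInf {z | ∃ a : A, (ofW F : (fiFrame A L).Complex) ≤ fiEmbed L a ∧ z = fiEmbed L (h.toFun a)} =
      (ofW (fiMap h.toBoundedLatticeHom .one F) : (fiFrame B L).Complex) := by
  apply eq_of_ext
  intro G
  refine mem_ext_sInf.trans (Iff.trans ?_ mem_ext_ofW.symm)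
  constructor
  · rintro hG b ⟨a, ha, hab⟩
    exact PFilter.mem_of_le hab (hG _ ⟨a, ofW_le_fiEmbed.2 ha, rfl⟩)
  · rintro hG _ ⟨a, ha, rfl⟩
    exact hG _ ⟨a, ofW_le_fiEmbed.1 ha, le_rfl⟩

/-- `h.delta x` is a join of closed elements, so its intent consists of the ideals meeting the image
filter of every `F` in the extent of `x`. An ideal meets that image iff its preimage meets `F`. -/
theorem mem_int_delta {x : (fiFrame A L).Complex} {I : (fiPolarity B).side .dual} :
    I ∈ (h.delta x).int ↔ fiComap h.toBoundedLatticeHom .dual I ∈ x.int := by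
  rw [LEHom.delta, canonicalMap]
  refine mem_int_sSup.trans (Iff.trans ?_ mem_int_iff.symm)
  constructor
  · intro hI F hF
    have := hI _ ⟨ofW F, isClosedElt_fiEmbed_iff.2 ⟨F, rfl⟩, ofW_le.2 hF,
      (sInf_fiEmbed_comp h F).symm⟩
    obtain ⟨b, ⟨a, ha, hab⟩, hb⟩ := ofW_le_ofU.1 (le_ofU.2 this)
    exact ⟨a, ha, Ideal.lower (show Ideal B from I) hab hb⟩
  · rintro hI _ ⟨k, hk, hkx, rfl⟩
    obtain ⟨F, rfl⟩ := isClosedElt_fiEmbed_iff.1 hk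
    obtain ⟨a, ha, haI⟩ := hI F (ofW_le.1 hkx)
    have hle : fiEmbed L (h.toFun a) ≤ (ofU I : (fiFrame B L).Complex) := fiEmbed_le_ofU.2 haI
    exact le_ofU.1 (le_trans (sInf_le ⟨a, ofW_le_fiEmbed.2 ha, rfl⟩) hle)

/-- The definition as a join gives direct access to intents only. Extents follow by polarity: an
ideal `J` in the intent of `x` is tested through the ideal generated by its image, whose preimage
contains `J`. -/
theorem mem_ext_delta {x : (fiFrame A L).Complex} {F : (fiPolarity B).side .one} :
    F ∈ (h.delta x).ext ↔ fiComap h.toBoundedLatticeHom .one F ∈ x.ext := by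
  constructor
  · refine fun hF => mem_ext_iff.2 fun J hJ => ?_
    obtain ⟨b, hbF, a, ha, hba⟩ := mem_ext_iff.1 hF (fiMap h.toBoundedLatticeHom .dual J)
      ((mem_int_delta h).2 (mem_comp_of_subset (s := .dual) (c := x) hJ
        (fiSet_subset_fiComap_fiMap h.toBoundedLatticeHom (s := .dual) J)))
    exact ⟨a, PFilter.mem_of_le (F := (show PFilter B from F)) hba hbF, ha⟩
  · refine fun hF => mem_ext_iff.2 fun I hI => ?_
    obtain ⟨a, haF, haI⟩ := mem_ext_iff.1 hF _ ((mem_int_delta h).1 hI)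
    exact ⟨_, haF, haI⟩

theorem mem_comp_delta {s : Sgn} {x : (fiFrame A L).Complex} {H : (fiPolarity B).side s} :
    H ∈ (fiFrame B L).comp (h.delta x) s ↔
      fiComap h.toBoundedLatticeHom s H ∈ (fiFrame A L).comp x s := by
  cases s with
  | one => exact mem_ext_delta h
  | dual => exact mem_int_delta h

/-- A point is related to all tuples whose preimages lie in given upward closed sets iff its
preimage is related to all tuples in these sets. -/
theorem fiRel_forall_fiComap_iff {n : ℕ} {t : Sgn} {η : Fin n → Sgn} {φ : BoundedLatticeHom A B}
    {opA : (Fin n → A) → A} {opB : (Fin n → B) → B}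
    (hop : ∀ a, φ (opA a) = opB fun i => φ (a i))
    (hmono : ∀ a b : Fin n → B, (∀ i, (η i).le (a i) (b i)) → t.le (opB b) (opB a))
    (X : ∀ i, Set ((fiPolarity A).side (η i)))
    (hX : ∀ i, ∀ H H', fiSet (η i) H ⊆ fiSet (η i) H' → H ∈ X i → H' ∈ X i)
    (x : (fiPolarity B).side t) :
    (∀ H : ∀ i, (fiPolarity B).side (η i), (∀ i, fiComap φ (η i) (H i) ∈ X i) →
      fiRel t η opB x H) ↔
    ∀ H : ∀ i, (fiPolarity A).side (η i), (∀ i, H i ∈ X i) →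
      fiRel t η opA (fiComap φ t x) H := by
  constructor
  · intro hx H hH
    -- The image tuple is admissible because the preimage of the image of `H i` contains `H i`. Its
    -- members are bounded by images of members of `H i`, to which monotonicity passes.
    obtain ⟨b, hb, hbx⟩ := hx (fun i => fiMap φ (η i) (H i)) fun i =>
      hX i _ _ (fiSet_subset_fiComap_fiMap φ (H i)) (hH i)
    choose a ha hab using fun i => mem_fiSet_fiMap.1 (hb i)
    refine ⟨a, ha, mem_fiSet_fiComap.2 ?_⟩
    rw [hop]
    exact fiSet_upper x (hmono _ _ hab) hbx
  · intro hx H hH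
    obtain ⟨a, ha, hax⟩ := hx _ hH
    refine ⟨fun i => φ (a i), fun i => mem_fiSet_fiComap.1 (ha i), ?_⟩
    rw [← hop]
    exact mem_fiSet_fiComap.1 hax

/-- Monotonicity of `f` in its order type, stated with the converse order on values to match the
hypothesis `hmono` of `fiRel_forall_fiComap_iff` at `t = .dual`. -/
theorem opF_le_of_le (f : L.F) {a b : Fin (L.arF f) → B}
    (hab : ∀ i, (L.epsF f i).le (a i) (b i)) :
    Sgn.dual.le (LEOps.opF f b) (LEOps.opF f a) := by
  refine fi_monotone (t := .one) (fun i a x y => ?_) hab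
  cases hi : L.epsF f i with
  | one => exact LEAlgebra.opF_sup f i hi a x y
  | dual => exact LEAlgebra.opF_inf f i hi a x y

theorem opG_le_of_le (g : L.G) {a b : Fin (L.arG g) → B}
    (hab : ∀ i, (L.epsG g i).op.le (a i) (b i)) :
    Sgn.one.le (LEOps.opG g b) (LEOps.opG g a) := by
  refine fi_monotone (t := .dual) (η := fun i => (L.epsG g i).op) (fun i a x y => ?_) hab
  cases hi : L.epsG g i with
  | one => exact LEAlgebra.opG_inf g i hi a x y
  | dual => exact LEAlgebra.opG_sup g i hi a x y

theorem isCompleteLEHom_delta : IsCompleteLEHom L h.delta where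
  map_sSup X := by
    apply eq_of_int
    intro I
    refine (mem_int_delta h).trans (mem_int_sSup.trans (Iff.trans ?_ mem_int_sSup.symm))
    rw [Set.forall_mem_image]
    exact forall₂_congr fun x _ => (mem_int_delta h).symm
  map_sInf X := by
    apply eq_of_ext
    intro F
    refine (mem_ext_delta h).trans (mem_ext_sInf.trans (Iff.trans ?_ mem_ext_sInf.symm))
    rw [Set.forall_mem_image]
    exact forall₂_congr fun x _ => (mem_ext_delta h).symm
  preservesOps :=
    { map_opF := fun f a => by
        apply eq_of_int
        intro I
        refine (mem_int_delta h).trans ?_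
        refine (fiRel_forall_fiComap_iff (t := .dual) (h.preservesOps.map_opF f)
          (fun _ _ => opF_le_of_le f) (fun i => (fiFrame A L).comp (a i) (L.epsF f i))
          (fun i H H' hs hH => mem_comp_of_subset hH hs) I).symm.trans ?_
        exact forall_congr' fun H => imp_congr_left (forall_congr' fun i => (mem_comp_delta h).symm)
      map_opG := fun g a => by
        apply eq_of_ext
        intro F
        refine (mem_ext_delta h).trans ?_
        refine (fiRel_forall_fiComap_iff (t := .one) (h.preservesOps.map_opG g)
          (fun _ _ => opG_le_of_le g) (fun i => (fiFrame A L).comp (a i) (L.epsG g i).op)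
          (fun i H H' hs hH => mem_comp_of_subset hH hs) F).symm.trans ?_
        exact forall_congr' fun H =>
          imp_congr_left (forall_congr' fun i => (mem_comp_delta h).symm) }

theorem delta_fiEmbed (a : A) : h.delta (fiEmbed L a) = fiEmbed L (h.toFun a) :=
  eq_of_ext fun _ => mem_ext_delta h

/-! ### The dual p-morphism -/

theorem dualS_iff {w : (fiPolarity B).side .one} {u : (fiPolarity A).side .dual} :
    dualS h.delta w u ↔ (fiPolarity A).N (fiComap h.toBoundedLatticeHom .one w) u :=
  (mem_ext_delta h).trans (ofW_le.symm.trans ofW_le_ofU)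

theorem dualT_iff {u : (fiPolarity B).side .dual} {w : (fiPolarity A).side .one} :
    dualT h.delta u w ↔ (fiPolarity A).N w (fiComap h.toBoundedLatticeHom .dual u) :=
  (mem_int_delta h).trans (le_ofU.symm.trans ofW_le_ofU)

theorem lowerPolar_dualS (Y : Set (Ideal A)) :
    lowerPolar (dualS h.delta) Y =
      {w | fiComap h.toBoundedLatticeHom .one w ∈ lowerPolar (fiPolarity A).N Y} :=
  Set.ext fun _ => forall₂_congr fun _ _ => dualS_iff h

theorem lowerPolar_dualT (X : Set (PFilter A)) :
    lowerPolar (dualT h.delta) X =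
      {u | fiComap h.toBoundedLatticeHom .dual u ∈ upperPolar (fiPolarity A).N X} :=
  Set.ext fun _ => forall₂_congr fun _ _ => dualT_iff h

/-- This translates surjectivity and injectivity of the p-morphism into properties of `h.delta`. -/
theorem lowerPolar_dualS_int (a : (fiFrame A L).Complex) :
    lowerPolar (dualS h.delta) a.int = (h.delta a).ext := by
  refine (lowerPolar_dualS h _).trans ?_
  ext F
  exact mem_ext_iff.symm.trans (mem_ext_delta h).symm

theorem pullSide_dual {s : Sgn} (H : (fiPolarity A).side s) :
    pullSide (fiFrame B L) (fiFrame A L) (dualS h.delta) (dualT h.delta) s H =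
      (fiFrame B L).comp (h.delta (ofSide s H)) s := by
  cases s with
  | one => exact Concept.lowerPolar_intent (r := (fiFrame B L).N) (h.delta (ofW H))
  | dual => exact Concept.upperPolar_extent (r := (fiFrame B L).N) (h.delta (ofU H))

/-- The right-hand side is kept as membership in a set of points closed under enlargement, the form
of `X` in `fiRel_forall_fiComap_iff`. -/
theorem mem_pullSide_dual {s : Sgn} {H : (fiPolarity A).side s} {G : (fiPolarity B).side s} :
    G ∈ pullSide (fiFrame B L) (fiFrame A L) (dualS h.delta) (dualT h.delta) s H ↔
      fiComap h.toBoundedLatticeHom s G ∈ {K | fiSet s H ⊆ fiSet s K} := by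
  rw [pullSide_dual]
  refine (mem_comp_delta h).trans ?_
  cases s with
  | one => exact mem_ext_ofW
  | dual => exact mem_int_ofU

/-- Enlarging the points of the tuple preserves `fiRel`, so the smallest tuple decides. A single
tuple thereby takes the quantified form needed for the transfer along preimages. -/
theorem forall_fiRel_superset_iff {A : Type*} [Lattice A] {n : ℕ} {t : Sgn} {η : Fin n → Sgn} {op : (Fin n → A) → A}
    {x : (fiPolarity A).side t} {H : ∀ i, (fiPolarity A).side (η i)} :
    (∀ K : ∀ i, (fiPolarity A).side (η i), (∀ i, K i ∈ {K | fiSet (η i) (H i) ⊆ fiSet (η i) K}) →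
      fiRel t η op x K) ↔ fiRel t η op x H :=
  ⟨fun hK => hK H fun _ => Set.Subset.rfl,
    fun ⟨a, ha, hax⟩ _ hK => ⟨a, fun i => hK i (ha i), hax⟩⟩

theorem isPMorphism_dual :
    IsPMorphism (fiFrame B L) (fiFrame A L) (dualS h.delta) (dualT h.delta) where
  p2_zero u := Concept.isExtent_extent (h.delta (ofU u))
  p2_one w := by
    have e : {u | dualS h.delta w u} =
        (ofW (fiComap h.toBoundedLatticeHom .one w) : (fiFrame A L).Complex).int :=
      Set.ext fun u => (dualS_iff h).trans
        (Iff.trans (ofW_le_ofU (𝔽 := fiFrame A L)).symm le_ofU)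
    exact e ▸ Concept.isIntent_intent (r := (fiFrame A L).N)
      (ofW (fiComap h.toBoundedLatticeHom .one w) : (fiFrame A L).Complex)
  p3_zero w := Concept.isIntent_intent (h.delta (ofW w))
  p3_one u := by
    have e : {w | dualT h.delta u w} =
        (ofU (fiComap h.toBoundedLatticeHom .dual u) : (fiFrame A L).Complex).ext :=
      Set.ext fun w => (dualT_iff h).trans
        (Iff.trans (ofW_le_ofU (𝔽 := fiFrame A L)).symm ofW_le)
    exact e ▸ Concept.isExtent_extent (r := (fiFrame A L).N)
      (ofU (fiComap h.toBoundedLatticeHom .dual u) : (fiFrame A L).Complex)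
  p4 w := by
    intro F hF u hu
    have hF' := (mem_pullSide_dual h (s := .one)).1 hF
    obtain ⟨a, haw, hau⟩ := hu
    exact (dualS_iff h).2 ⟨a, hF' haw, hau⟩
  p5 w := by
    -- The preimage of `w` itself belongs to the lower polar of the points `S`-related to `w`.
    intro u hu
    obtain ⟨a, haw, hau⟩ := (dualT_iff h).1 (hu (b := fiComap h.toBoundedLatticeHom .one w)
      fun I hI => (dualS_iff h).1 hI)
    exact ⟨_, haw, hau⟩
  p6 f w := by
    refine (lowerPolar_dualT h _).trans ?_
    -- Since `T^{(0)}` is the preimage of an upper polar, the left side involves a double polar,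
    -- which stability removes.
    have hst := isIntent_iff.1 (((fiFrame A L).compatF f).1 w)
    ext I
    refine (Set.ext_iff.1 hst _).trans (forall_fiRel_superset_iff.symm.trans ?_)
    refine (fiRel_forall_fiComap_iff (t := .dual) (h.preservesOps.map_opF f)
      (fun _ _ => opF_le_of_le f) (fun i => {K | fiSet _ (w i) ⊆ fiSet _ K})
      (fun i H H' hs hH => Set.Subset.trans hH hs) I).symm.trans ?_
    exact forall_congr' fun H => imp_congr_left (forall_congr' fun i => (mem_pullSide_dual h).symm)
  p7 g u := by
    refine (lowerPolar_dualS h _).trans ?_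
    have hst := isExtent_iff.1 (((fiFrame A L).compatG g).1 u)
    ext F
    refine (Set.ext_iff.1 hst _).trans (forall_fiRel_superset_iff.symm.trans ?_)
    refine (fiRel_forall_fiComap_iff (t := .one) (h.preservesOps.map_opG g)
      (fun _ _ => opG_le_of_le g) (fun i => {K | fiSet _ (u i) ⊆ fiSet _ K})
      (fun i H H' hs hH => Set.Subset.trans hH hs) F).symm.trans ?_
    exact forall_congr' fun H => imp_congr_left (forall_congr' fun i => (mem_pullSide_dual h).symm)

/-! ### Injective and surjective homomorphisms -/

variable {h}

theorem delta_injective (hh : Function.Injective h.toFun) : Function.Injective h.delta := by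
  have key : ∀ a b : (fiFrame A L).Complex, h.delta a = h.delta b → ∀ F ∈ a.ext, F ∈ b.ext := by
    intro a b hab F hF
    -- The image of `F` witnesses that `F` is in the extent of `a`; injectivity of `h` ensures that
    -- its preimage is no larger than `F`.
    have h₁ : fiMap h.toBoundedLatticeHom .one F ∈ (h.delta a).ext :=
      (mem_ext_delta h).2 (mem_comp_of_subset (s := .one) (c := a) hF
        (fiSet_subset_fiComap_fiMap _ (s := .one) F))
    rw [hab] at h₁
    exact mem_comp_of_subset (s := .one) (c := b) ((mem_ext_delta h).1 h₁)
      (fiSet_fiComap_fiMap_subset (φ := h.toBoundedLatticeHom) hh (s := .one) F)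
  exact fun a b hab => eq_of_ext fun F => ⟨key a b hab F, key b a hab.symm F⟩

theorem delta_surjective (hh : Function.Surjective h.toFun) : Function.Surjective h.delta := by
  intro c
  have hW : ∀ F : PFilter B,
      h.delta (ofW (fiComap h.toBoundedLatticeHom .one F)) = ofW F := by
    intro F
    refine eq_of_ext fun G =>
      (mem_ext_delta h).trans (mem_ext_ofW.trans (Iff.trans ?_ mem_ext_ofW.symm))
    refine ⟨fun hG b hb => ?_, fun hG a ha => hG _ ha⟩
    -- By surjectivity a filter of `B` is determined by its preimage, so an inclusion of preimages
    -- is an inclusion of filters.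
    obtain ⟨a, rfl⟩ := hh b
    exact hG a hb
  -- `c` is the join of the closed elements below it; each is hit by `hW`, and `h.delta` preserves
  -- joins.
  refine ⟨sSup ((fun F => ofW (fiComap h.toBoundedLatticeHom .one F)) '' c.ext), ?_⟩
  refine ((isCompleteLEHom_delta h).map_sSup _).trans (Eq.trans ?_ (eq_sSup_ofW c).symm)
  refine congrArg sSup ((Set.image_image _ _ _).trans ?_)
  exact Set.image_congr fun F _ => hW F

theorem isSurjectivePMorphism_dual (hh : Function.Injective h.toFun) :
    IsSurjectivePMorphism (fiFrame B L) (fiFrame A L) (dualS h.delta) (dualT h.delta) where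
  toIsPMorphism := isPMorphism_dual h
  surj a b hab e := by
    rw [lowerPolar_dualS_int, lowerPolar_dualS_int] at e
    exact hab (delta_injective hh (eq_of_ext (Set.ext_iff.1 e)))

theorem isInjectivePMorphism_dual (hh : Function.Surjective h.toFun) :
    IsInjectivePMorphism (fiFrame B L) (fiFrame A L) (dualS h.delta) (dualT h.delta) where
  toIsPMorphism := isPMorphism_dual h
  inj a := by
    obtain ⟨b, rfl⟩ := delta_surjective hh a
    exact ⟨b, lowerPolar_dualS_int h b⟩

end Delta

theorem mainTheorem5 {L : LESig} {A B : Type*}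
    [Lattice A] [BoundedOrder A] [LEAlgebra L A] [Lattice B] [BoundedOrder B] [LEAlgebra L B]
    (h : LEHom L A B) :
    (IsLECanonicalExtension L (fiEmbed L : A → (fiFrame A L).Complex) ∧
      IsLECanonicalExtension L (fiEmbed L : B → (fiFrame B L).Complex) ∧
      IsCompleteLEHom L h.delta ∧
      ∀ a : A, h.delta (fiEmbed L a) = fiEmbed L (h.toFun a)) ∧
    (Function.Injective h.toFun →
      IsSurjectivePMorphism (fiFrame B L) (fiFrame A L) (dualS h.delta) (dualT h.delta) ∧
        IsPMorphicImage (fiFrame B L) (fiFrame A L)) ∧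
    (Function.Surjective h.toFun →
      IsInjectivePMorphism (fiFrame B L) (fiFrame A L) (dualS h.delta) (dualT h.delta) ∧
        IsGeneratedSubframe (fiFrame B L) (fiFrame A L)) :=
  ⟨⟨isLECanonicalExtension_fiEmbed, isLECanonicalExtension_fiEmbed, isCompleteLEHom_delta h,
    delta_fiEmbed h⟩,
    fun hh => ⟨isSurjectivePMorphism_dual hh, _, _, isSurjectivePMorphism_dual hh⟩,
    fun hh => ⟨isInjectivePMorphism_dual hh, _, _, isInjectivePMorphism_dual hh⟩⟩
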